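/- Let $\mathcal A=\mathbb Q\langle x,y\rangle$ be the noncommutative polynomial algebra. Let $\mathcal H$ be the Connes–Kreimer algebra of rooted trees: the $\mathbb Q$-vector space freely generated by rooted forests (finite multisets of non-plane rooted trees), with the commutative product given by the union of forests; its unit is the empty forest $\mathbb I$. Let $B_+:\mathcal H\to\mathcal H$ be the linear map that grafts all roots of a forest on a common new root, so that $\bullet=B_+(\mathbb I)$ is the one-vertex tree. The coproduct $\Delta:\mathcal H\to\mathcal H\otimes\mathcal H$ is the algebra homomorphism with $\Delta(t)=\mathbb I\otimes t+(B_+\otimes\mathrm{id})\Delta(f)$ for every tree $t=B_+(f)$, $f$ a forest; write $\Delta(f)=\sum_{(f)}f'\otimes f''$. Let $L_u$ denote left multiplication by $u\in\mathcal A$; the operator $L_yL_{x+2y}L_y^{-1}$ is defined on $y\mathcal A$ by $yv\mapsto y(x+2y)v$. The rooted tree maps are the linear maps $\tilde f:\mathcal A\to\mathcal A$, depending linearly on $f\in\mathcal H$, that are uniquely determined by the following rules: (1) $\tilde{\mathbb I}=\mathrm{id}$; (2) $\tilde\bullet(x)=yx$ and $\tilde\bullet(y)=-yx$; (3) $\tilde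 t(u)=L_yL_{x+2y}L_y^{-1}\tilde f(u)$ for $u\in\{x,y\}$ if $t=B_+(f)$ with a forest $f\neq\mathbb I$ (then $\tilde f(u)\in y\mathcal A$); (4) $\widetilde{gh}=\tilde g\circ\tilde h$ for $g,h\in\mathcal H$; (5) $\tilde f(uw)=\sum_{(f)}\tilde{f'}(u)\,\tilde{f''}(w)$ for $f\in\mathcal H$, $u\in\{x,y\}$ and $w\in\mathcal A$. The product $\diamond$ on $\mathcal A$ is the $\mathbb Q$-bilinear product with $w\diamond1=1\diamond w=w$ and $$\begin{aligned} xw_1\diamond xw_2&=x(w_1\diamond xw_2)-x(yw_1\diamond w_2),\\ xw_1\diamond yw_2&=x(w_1\diamond yw_2)+y(xw_1\diamond w_2),\\ yw_1\diamond xw_2&=y(w_1\diamond xw_2)+x(yw_1\diamond w_2),\\ yw_1\diamond yw_2&=y(w_1\diamond yw_2)-y(xw_1\diamond w_2) \end{aligned}$$ for $w,w_1,w_2\in\mathcal A$. The polynomials $F_f\in\mathcal A$, depending linearly on $f\in\mathcal H$, are uniquely determined by $F_{\mathbb I}=1$; $F_\bullet=y$; $F_{B_+(f)}=L_yL_{x+2y}L_y^{-1}(F_f)$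 for a forest $f\neq\mathbb I$ (then $F_f\in y\mathcal A$); and $F_{gh}=F_g\diamond F_h$ for forests $g,h$. Theorem. For all $f\in\mathcal H$ and $w\in\mathcal A$, $$\tilde f(wx)=(F_f\diamond w)\,x .$$ -/

import Mathlib

namespace RootedTrees

/-- Plane rooted trees: a root together with the list of the subtrees attached to it. -/
inductive PlaneTree : Type
  | node : List PlaneTree → PlaneTree

namespace PlaneTree

/-- Elementary changes of the plane structure: permuting the subtrees attached to the root, or
making such a change inside one of these subtrees. -/
inductive Reorder : PlaneTree → PlaneTree → Prop
  | perm {l m : List PlaneTree} : l.Perm m → Reorder (node l) (node m)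
  | inside {s t : PlaneTree} (l r : List PlaneTree) :
      Reorder s t → Reorder (node (l ++ s :: r)) (node (l ++ t :: r))

theorem induction {P : PlaneTree → Prop} (h : ∀ l, (∀ t ∈ l, P t) → P (node l)) : ∀ t, P t
  | node l => h l (fun t _ => induction h t)

/-- The fold of a plane tree in a monoid: the value at a tree is obtained by `G` from the product
of the values at the subtrees attached to the root. -/
def fold {M : Type*} [Monoid M] (G : M → M) : PlaneTree → M
  | node l => G ((l.map (fold G)).prod)

end PlaneTree

/-- Rooted trees without plane structure. -/
def RootedTree : Type := Quot PlaneTree.Reorder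

/-- Forests: finite collections of rooted trees, with multiplicity and without order. The sum of
multisets is the product of forests, and `0` is the empty forest. -/
abbrev Forest : Type := Multiset RootedTree

/-- The rooted tree underlying a plane tree. -/
def RootedTree.mk (t : PlaneTree) : RootedTree := Quot.mk _ t

/-- A plane tree underlying which is the given rooted tree. -/
noncomputable def RootedTree.out (t : RootedTree) : PlaneTree := Quot.out t

theorem map_mk_map_out (l : List RootedTree) :
    (l.map RootedTree.out).map RootedTree.mk = l := by
  rw [List.map_map]
  refine (List.map_congr_left fun t _ => ?_).trans (List.map_id l)
  exact Quot.out_eq t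

/-- Graft the roots of all trees of a forest on a common new root. -/
noncomputable def graft (f : Forest) : RootedTree :=
  RootedTree.mk (PlaneTree.node (f.toList.map RootedTree.out))

theorem mk_node_eq_aux : ∀ (l m p : List PlaneTree), l.map RootedTree.mk = m.map RootedTree.mk →
    RootedTree.mk (.node (p ++ l)) = RootedTree.mk (.node (p ++ m))
  | [], [], _, _ => rfl
  | [], _ :: _, _, h => by simp at h
  | _ :: _, [], _, h => by simp at h
  | s :: l, t :: m, p, h => by
    simp only [List.map_cons, List.cons.injEq] at h
    have h1 : RootedTree.mk (.node (p ++ s :: l)) = RootedTree.mk (.node (p ++ t :: l)) := by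
      have h2 := Quot.eqvGen_exact h.1
      clear h
      induction h2 with
      | rel a b hab => exact Quot.sound (.inside p l hab)
      | refl a => rfl
      | symm a b _ ih => exact ih.symm
      | trans a b c _ _ ih1 ih2 => exact ih1.trans ih2
    rw [h1]
    simpa using mk_node_eq_aux l m (p ++ [t]) h.2

theorem mk_node (l : List PlaneTree) :
    RootedTree.mk (.node l) = graft (l.map RootedTree.mk : List RootedTree) := by
  have hp : (Multiset.toList ((l.map RootedTree.mk : List RootedTree) : Forest)).Perm
      (l.map RootedTree.mk) := by
    rw [← Multiset.coe_eq_coe, Multiset.coe_toList]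
  have h1 : graft (l.map RootedTree.mk : List RootedTree) =
      RootedTree.mk (.node ((l.map RootedTree.mk).map RootedTree.out)) :=
    Quot.sound (.perm (hp.map _))
  rw [h1]
  refine mk_node_eq_aux l _ [] ?_
  rw [map_mk_map_out]

/-- The forest of the subtrees attached to the root. -/
def RootedTree.children : RootedTree → Forest :=
  Quot.lift (fun t => match t with | .node l => ((l.map RootedTree.mk : List RootedTree) : Forest))
    (by
      intro a b h
      cases h with
      | perm h => exact Multiset.coe_eq_coe.2 (h.map _)
      | inside l r h =>
        have : RootedTree.mk _ = RootedTree.mk _ := Quot.sound h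
        simp [this])

theorem children_graft (f : Forest) : (graft f).children = f := by
  change ((List.map RootedTree.mk (f.toList.map RootedTree.out) : List RootedTree) : Forest) = f
  rw [map_mk_map_out, Multiset.coe_toList]

theorem graft_children (t : RootedTree) : graft t.children = t := by
  induction t using Quot.ind with
  | _ t =>
    cases t with
    | node l => exact (mk_node l).symm

theorem graft_bijective : Function.Bijective graft :=
  ⟨Function.LeftInverse.injective children_graft, Function.RightInverse.surjective graft_children⟩

theorem Forest.induction {P : Forest → Prop} (h0 : P 0) (hg : ∀ f, P f → P {graft f})
    (hadd : ∀ f g, P f → P g → P (f + g)) (f : Forest) : P f := by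
  have ht : ∀ t : PlaneTree, P {RootedTree.mk t} := by
    intro t
    induction t using PlaneTree.induction with
    | h l ih =>
      rw [mk_node]
      apply hg
      induction l with
      | nil => exact h0
      | cons a l ihl =>
        rw [List.map_cons, ← Multiset.cons_coe, ← Multiset.singleton_add]
        exact hadd _ _ (ih a (by simp)) (ihl fun t ht => ih t (by simp [ht]))
  induction f using Multiset.induction with
  | empty => exact h0
  | cons a f ihf =>
    rw [← Multiset.singleton_add]
    refine hadd _ _ ?_ ihf
    obtain ⟨t, rfl⟩ := Quot.exists_rep a
    exact ht t

theorem exists_fold {M : Type*} [Monoid M] (G : M → M)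
    (hc : ∀ s t : PlaneTree, Commute (PlaneTree.fold G s) (PlaneTree.fold G t)) :
    ∃ φ : Multiplicative Forest →* M, ∀ f : Forest,
      φ (.ofAdd {graft f}) = G (φ (.ofAdd f)) := by
  have hr : ∀ s t, PlaneTree.Reorder s t → PlaneTree.fold G s = PlaneTree.fold G t := by
    intro s t h
    induction h with
    | @perm l m h =>
      rw [PlaneTree.fold, PlaneTree.fold]
      congr 1
      refine List.Perm.prod_eq' (h.map _) ?_
      rw [List.pairwise_map]
      exact List.pairwise_of_forall fun a b => hc a b
    | inside l r h ih => simp [PlaneTree.fold, ih]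
  let ψ : RootedTree → M := Quot.lift (PlaneTree.fold G) hr
  have hψ : ∀ a b, Commute (ψ a) (ψ b) := fun a b =>
    Quot.induction_on₂ a b hc
  have hψ' : ∀ f : Forest, {x | x ∈ f.map ψ}.Pairwise Commute := by
    intro f x hx y hy _
    obtain ⟨a, _, rfl⟩ := Multiset.mem_map.1 hx
    obtain ⟨b, _, rfl⟩ := Multiset.mem_map.1 hy
    exact hψ a b
  let φ : Multiplicative Forest →* M :=
    { toFun := fun f => (f.toAdd.map ψ).noncommProd (hψ' _)
      map_one' := by simp
      map_mul' := fun f g => by simp only [toAdd_mul, Multiset.map_add, Multiset.noncommProd_add] }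
  have hφ : ∀ l : List PlaneTree, φ (.ofAdd ((l.map RootedTree.mk : List RootedTree) : Forest)) =
      (l.map (PlaneTree.fold G)).prod := by
    intro l
    change (((l.map RootedTree.mk : List RootedTree) : Forest).map ψ).noncommProd (hψ' _) = _
    simp only [Multiset.map_coe, List.map_map, Multiset.noncommProd_coe]
    rfl
  refine ⟨φ, fun f => ?_⟩
  obtain ⟨l, rfl⟩ : ∃ l : List PlaneTree, f = (l.map RootedTree.mk : List RootedTree) :=
    ⟨f.toList.map RootedTree.out, (children_graft f).symm⟩
  rw [← mk_node, hφ]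
  refine (hφ [.node l]).trans ?_
  rw [List.map_singleton, List.prod_singleton, PlaneTree.fold]

open scoped TensorProduct

/-- The Connes–Kreimer algebra: the `ℚ`-vector space freely generated by the rooted forests, with
the commutative product given by the product of forests. -/
abbrev CK : Type := AddMonoidAlgebra ℚ Forest

/-- A forest as a basis element of the Connes–Kreimer algebra. -/
noncomputable def ofForest (f : Forest) : CK := AddMonoidAlgebra.single f 1

theorem ofForest_zero : ofForest 0 = 1 := rfl

theorem ofForest_add (f g : Forest) : ofForest (f + g) = ofForest f * ofForest g := by
  simp [ofForest, AddMonoidAlgebra.single_mul_single]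

/-- The linear map `B₊`: on a forest, graft all roots on a common new root. -/
noncomputable def Bplus : CK →ₗ[ℚ] CK :=
  AddMonoidAlgebra.mapDomainLinearMap ℚ ℚ (fun f : Forest => ({graft f} : Forest))

theorem Bplus_ofForest (f : Forest) : Bplus (ofForest f) = ofForest {graft f} :=
  AddMonoidAlgebra.mapDomainLinearMap_single _ _ _

theorem linearMap_ext_forest {V : Type*} [AddCommGroup V] [Module ℚ V] {φ ψ : CK →ₗ[ℚ] V}
    (h : ∀ f, φ (ofForest f) = ψ (ofForest f)) : φ = ψ := by
  refine LinearMap.ext fun a => ?_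
  induction a using AddMonoidAlgebra.induction_linear with
  | zero => simp
  | add a b ha hb => simp [ha, hb]
  | single f r =>
    have : AddMonoidAlgebra.single f r = r • ofForest f := by
      simp [ofForest]
    rw [this, map_smul, map_smul, h]

/-- The recursive rule of the coproduct on a tree `t = B₊(f)`, for an algebra homomorphism:
`Δ(t) = 1 ⊗ t + (B₊ ⊗ id)(Δ(f))`. -/
def IsCoproduct (D : CK →ₐ[ℚ] CK ⊗[ℚ] CK) : Prop :=
  ∀ f : Forest, D (ofForest {graft f}) =
    1 ⊗ₜ[ℚ] ofForest {graft f} + TensorProduct.map Bplus LinearMap.id (D (ofForest f))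

theorem existsUnique_coproduct : ∃! D : CK →ₐ[ℚ] CK ⊗[ℚ] CK, IsCoproduct D := by
  obtain ⟨φ, hφ⟩ := exists_fold (M := CK × (CK ⊗[ℚ] CK))
    (fun p => (Bplus p.1, 1 ⊗ₜ[ℚ] Bplus p.1 + TensorProduct.map Bplus LinearMap.id p.2))
    (fun _ _ => Commute.all _ _)
  have h1 : ∀ f : Forest, (φ (.ofAdd f)).1 = ofForest f := by
    intro f
    induction f using Forest.induction with
    | h0 => rw [ofAdd_zero, map_one]; rfl
    | hg f ih => rw [hφ, ih, Bplus_ofForest]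
    | hadd f g hf hg => rw [ofAdd_add, map_mul, Prod.fst_mul, hf, hg, ofForest_add]
  refine ⟨AddMonoidAlgebra.lift ℚ _ _ ((MonoidHom.snd _ _).comp φ), ?_, ?_⟩
  · intro f
    have : ∀ f : Forest, (AddMonoidAlgebra.lift ℚ (CK ⊗[ℚ] CK) Forest
        ((MonoidHom.snd _ _).comp φ)) (ofForest f) = (φ (.ofAdd f)).2 := fun f => by
      simp [ofForest, AddMonoidAlgebra.lift_single]
    rw [this, this, hφ, h1, Bplus_ofForest]
  · intro D hD
    have key : ∀ f : Forest, D (ofForest f) = (φ (.ofAdd f)).2 := by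
      intro f
      induction f using Forest.induction with
      | h0 => rw [ofAdd_zero, map_one, ofForest_zero, map_one]; rfl
      | hg f ih => rw [hφ, hD, h1, ih, Bplus_ofForest]
      | hadd f g hf hg => rw [ofAdd_add, map_mul, ofForest_add, map_mul, Prod.snd_mul, hf, hg]
    apply AlgHom.toLinearMap_injective
    apply linearMap_ext_forest
    intro f
    refine (key f).trans ?_
    simp [ofForest, AddMonoidAlgebra.lift_single]

/-- The coproduct `Δ` of the Connes–Kreimer Hopf algebra. -/
noncomputable def coproduct : CK →ₐ[ℚ] CK ⊗[ℚ] CK := existsUnique_coproduct.choose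

theorem isCoproduct_coproduct : IsCoproduct coproduct := existsUnique_coproduct.choose_spec.1


/-- The two indeterminates. -/
inductive Letter : Type
  | x
  | y

/-- The noncommutative polynomial algebra `ℚ⟨x, y⟩`. -/
abbrev NCPoly : Type := FreeAlgebra ℚ Letter

/-- The indeterminate `x`. -/
noncomputable def X : NCPoly := FreeAlgebra.ι ℚ Letter.x

/-- The indeterminate `y`. -/
noncomputable def Y : NCPoly := FreeAlgebra.ι ℚ Letter.y

/-- The word with the given list of letters. -/
noncomputable def word (l : List Letter) : NCPoly := (l.map (FreeAlgebra.ι ℚ)).prod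

theorem word_nil : word [] = 1 := rfl

theorem word_x (l : List Letter) : word (.x :: l) = X * word l := by
  simp [word, X]

theorem word_y (l : List Letter) : word (.y :: l) = Y * word l := by
  simp [word, Y]

/-- The words form a basis. -/
noncomputable def wordBasis : Module.Basis (List Letter) ℚ NCPoly :=
  (FreeAlgebra.basisFreeMonoid ℚ Letter).reindex FreeMonoid.toList

theorem wordBasis_apply (l : List Letter) : wordBasis l = word l := by
  rw [wordBasis, Module.Basis.reindex_apply, FreeAlgebra.basisFreeMonoid]
  simp [FreeAlgebra.equivMonoidAlgebraFreeMonoid, word, FreeMonoid.lift_apply]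

theorem linearMap_ext_word {V : Type*} [AddCommGroup V] [Module ℚ V] {φ ψ : NCPoly →ₗ[ℚ] V}
    (h : ∀ l, φ (word l) = ψ (word l)) : φ = ψ :=
  wordBasis.ext fun l => by rw [wordBasis_apply, h]

/-- The linear map with given values on words. -/
noncomputable def onWords {V : Type*} [AddCommGroup V] [Module ℚ V] (v : List Letter → V) :
    NCPoly →ₗ[ℚ] V :=
  wordBasis.constr ℚ v

theorem onWords_word {V : Type*} [AddCommGroup V] [Module ℚ V] (v : List Letter → V)
    (l : List Letter) : onWords v (word l) = v l := by
  rw [onWords, ← wordBasis_apply, Module.Basis.constr_basis]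

/-- The product `⋄` on words, by recursion on the total length. -/
noncomputable def diamondWord : List Letter → List Letter → NCPoly
  | [], v => word v
  | u, [] => word u
  | .x :: u, .x :: v => X * diamondWord u (.x :: v) - X * diamondWord (.y :: u) v
  | .x :: u, .y :: v => X * diamondWord u (.y :: v) + Y * diamondWord (.x :: u) v
  | .y :: u, .x :: v => Y * diamondWord u (.x :: v) + X * diamondWord (.y :: u) v
  | .y :: u, .y :: v => Y * diamondWord u (.y :: v) - Y * diamondWord (.x :: u) v
termination_by u v => u.length + v.length

/-- The product `⋄` on `ℚ⟨x, y⟩`. -/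
noncomputable def diamond : NCPoly →ₗ[ℚ] NCPoly →ₗ[ℚ] NCPoly :=
  onWords fun u => onWords fun v => diamondWord u v

theorem diamond_word (u v : List Letter) : diamond (word u) (word v) = diamondWord u v := by
  rw [diamond, onWords_word, onWords_word]

theorem bilinear_ext_word {V : Type*} [AddCommGroup V] [Module ℚ V]
    {φ ψ : NCPoly →ₗ[ℚ] NCPoly →ₗ[ℚ] V}
    (h : ∀ u v, φ (word u) (word v) = ψ (word u) (word v)) (a b : NCPoly) : φ a b = ψ a b := by
  have : φ = ψ := linearMap_ext_word fun u => linearMap_ext_word fun v => h u v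
  rw [this]

theorem one_diamond (a : NCPoly) : diamond 1 a = a := by
  have : diamond 1 = LinearMap.id := linearMap_ext_word fun v => by
    rw [← word_nil, diamond_word, diamondWord]; rfl
  rw [this]; rfl

theorem diamond_one (a : NCPoly) : diamond a 1 = a := by
  have : diamond.flip 1 = LinearMap.id := linearMap_ext_word fun v => by
    rw [LinearMap.flip_apply, ← word_nil, diamond_word]
    cases v <;> rw [diamondWord] <;> simp
  exact congrArg (fun φ => φ a) this

theorem diamond_x_x (a b : NCPoly) :
    diamond (X * a) (X * b) = X * diamond a (X * b) - X * diamond (Y * a) b := by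
  have := bilinear_ext_word (φ := diamond.compl₁₂ (LinearMap.mulLeft ℚ X) (LinearMap.mulLeft ℚ X))
    (ψ := (diamond.compl₂ (LinearMap.mulLeft ℚ X)).compr₂ (LinearMap.mulLeft ℚ X) - (diamond.comp (LinearMap.mulLeft ℚ Y)).compr₂ (LinearMap.mulLeft ℚ X))
    (fun u v => by
      simp only [LinearMap.compl₁₂_apply, LinearMap.sub_apply, LinearMap.compr₂_apply,
        LinearMap.compl₂_apply, LinearMap.comp_apply, LinearMap.mulLeft_apply, ← word_x, ← word_y,
        diamond_word]
      rw [diamondWord]) a b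
  simpa using this

theorem diamond_x_y (a b : NCPoly) :
    diamond (X * a) (Y * b) = X * diamond a (Y * b) + Y * diamond (X * a) b := by
  have := bilinear_ext_word (φ := diamond.compl₁₂ (LinearMap.mulLeft ℚ X) (LinearMap.mulLeft ℚ Y))
    (ψ := (diamond.compl₂ (LinearMap.mulLeft ℚ Y)).compr₂ (LinearMap.mulLeft ℚ X) + (diamond.comp (LinearMap.mulLeft ℚ X)).compr₂ (LinearMap.mulLeft ℚ Y))
    (fun u v => by
      simp only [LinearMap.compl₁₂_apply, LinearMap.add_apply, LinearMap.compr₂_apply,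
        LinearMap.compl₂_apply, LinearMap.comp_apply, LinearMap.mulLeft_apply, ← word_x, ← word_y,
        diamond_word]
      rw [diamondWord]) a b
  simpa using this

theorem diamond_y_x (a b : NCPoly) :
    diamond (Y * a) (X * b) = Y * diamond a (X * b) + X * diamond (Y * a) b := by
  have := bilinear_ext_word (φ := diamond.compl₁₂ (LinearMap.mulLeft ℚ Y) (LinearMap.mulLeft ℚ X))
    (ψ := (diamond.compl₂ (LinearMap.mulLeft ℚ X)).compr₂ (LinearMap.mulLeft ℚ Y) + (diamond.comp (LinearMap.mulLeft ℚ Y)).compr₂ (LinearMap.mulLeft ℚ X))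
    (fun u v => by
      simp only [LinearMap.compl₁₂_apply, LinearMap.add_apply, LinearMap.compr₂_apply,
        LinearMap.compl₂_apply, LinearMap.comp_apply, LinearMap.mulLeft_apply, ← word_x, ← word_y,
        diamond_word]
      rw [diamondWord]) a b
  simpa using this

theorem diamond_y_y (a b : NCPoly) :
    diamond (Y * a) (Y * b) = Y * diamond a (Y * b) - Y * diamond (X * a) b := by
  have := bilinear_ext_word (φ := diamond.compl₁₂ (LinearMap.mulLeft ℚ Y) (LinearMap.mulLeft ℚ Y))
    (ψ := (diamond.compl₂ (LinearMap.mulLeft ℚ Y)).compr₂ (LinearMap.mulLeft ℚ Y) - (diamond.comp (LinearMap.mulLeft ℚ X)).compr₂ (LinearMap.mulLeft ℚ Y))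
    (fun u v => by
      simp only [LinearMap.compl₁₂_apply, LinearMap.sub_apply, LinearMap.compr₂_apply,
        LinearMap.compl₂_apply, LinearMap.comp_apply, LinearMap.mulLeft_apply, ← word_x, ← word_y,
        diamond_word]
      rw [diamondWord]) a b
  simpa using this

theorem word_induction {P : NCPoly → Prop} (h1 : P 1) (hadd : ∀ a b, P a → P b → P (a + b))
    (hsmul : ∀ (c : ℚ) a, P a → P (c • a)) (hz : ∀ a, P a → P ((X + Y) * a))
    (hx : ∀ a, P a → P (X * a)) (a : NCPoly) : P a := by
  have hw : ∀ l, P (word l) := by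
    intro l
    induction l with
    | nil => exact h1
    | cons s l ih =>
      cases s with
      | x => rw [word_x]; exact hx _ ih
      | y =>
        have : Y * word l = (X + Y) * word l + (-1 : ℚ) • (X * word l) := by
          rw [add_mul, neg_smul, one_smul]; abel
        rw [word_y, this]
        exact hadd _ _ (hz _ ih) (hsmul _ _ (hx _ ih))
  have ha : a ∈ Submodule.span ℚ (Set.range word) := by
    have : (wordBasis : List Letter → NCPoly) = word := funext wordBasis_apply
    rw [← this, wordBasis.span_eq]
    trivial
  have h0 : P 0 := by simpa using hsmul 0 1 h1
  induction ha using Submodule.span_induction with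
  | mem _ h => obtain ⟨l, rfl⟩ := h; exact hw l
  | zero => exact h0
  | add a b _ _ ha hb => exact hadd _ _ ha hb
  | smul c a _ ha => exact hsmul _ _ ha

theorem z_diamond (a b : NCPoly) : diamond ((X + Y) * a) b = (X + Y) * diamond a b := by
  induction b using word_induction with
  | h1 => rw [diamond_one, diamond_one]
  | hadd b c hb hc => rw [map_add, map_add, hb, hc, mul_add]
  | hsmul c b hb => rw [map_smul, map_smul, hb, mul_smul_comm]
  | hz b _ =>
    simp only [add_mul, map_add, LinearMap.add_apply, diamond_x_x, diamond_x_y, diamond_y_x,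
      diamond_y_y, mul_add]
    abel
  | hx b _ =>
    simp only [add_mul, map_add, LinearMap.add_apply, diamond_x_x, diamond_y_x]
    abel

theorem y_diamond (a b : NCPoly) :
    diamond (Y * a) b = (X + Y) * diamond a b - diamond (X * a) b := by
  rw [← z_diamond, add_mul, map_add, LinearMap.add_apply]
  abel

theorem diamond_z (a b : NCPoly) : diamond a ((X + Y) * b) = (X + Y) * diamond a b := by
  induction a using word_induction with
  | h1 => rw [one_diamond, one_diamond]
  | hadd a c ha hc => simp only [map_add, LinearMap.add_apply, ha, hc, mul_add]
  | hsmul c a ha => simp only [map_smul, LinearMap.smul_apply, ha, mul_smul_comm]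
  | hz a ha => rw [z_diamond, z_diamond, ha]
  | hx a ha =>
    have h : diamond (X * a) ((X + Y) * b) =
        X * diamond a ((X + Y) * b) - X * diamond (Y * a) b + Y * diamond (X * a) b := by
      simp only [add_mul, map_add, diamond_x_x, diamond_x_y, mul_add]
      abel
    rw [h, ha, y_diamond]
    simp only [add_mul, mul_add, mul_sub]
    abel

theorem diamond_x_x' (a b : NCPoly) : diamond (X * a) (X * b) =
    X * (diamond a (X * b) + diamond (X * a) b - (X + Y) * diamond a b) := by
  rw [diamond_x_x, y_diamond, ← mul_sub]
  congr 1
  abel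

theorem diamond_comm (a b : NCPoly) : diamond a b = diamond b a := by
  induction a using word_induction generalizing b with
  | h1 => rw [one_diamond, diamond_one]
  | hadd a c ha hc => rw [map_add, map_add, LinearMap.add_apply, ha, hc]
  | hsmul c a ha => rw [map_smul, map_smul, LinearMap.smul_apply, ha]
  | hz a ha => rw [z_diamond, diamond_z, ha]
  | hx a ha =>
    induction b using word_induction with
    | h1 => rw [one_diamond, diamond_one]
    | hadd b c hb hc => rw [map_add, map_add, LinearMap.add_apply, hb, hc]
    | hsmul c b hb => rw [map_smul, map_smul, LinearMap.smul_apply, hb]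
    | hz b hb => rw [z_diamond, diamond_z, hb]
    | hx b hb =>
      rw [diamond_x_x', diamond_x_x', ha, hb, ha b, add_comm (diamond _ a)]

theorem diamond_assoc (a b c : NCPoly) :
    diamond (diamond a b) c = diamond a (diamond b c) := by
  induction a using word_induction generalizing b c with
  | h1 => simp only [one_diamond]
  | hadd a d ha hd => simp only [map_add, LinearMap.add_apply, ha, hd]
  | hsmul r a ha => simp only [map_smul, LinearMap.smul_apply, ha]
  | hz a ha => simp only [z_diamond, ha]
  | hx a ha =>
    induction b using word_induction generalizing c with
    | h1 => simp only [one_diamond, diamond_one]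
    | hadd b d hb hd => simp only [map_add, LinearMap.add_apply, hb, hd]
    | hsmul r b hb => simp only [map_smul, LinearMap.smul_apply, hb]
    | hz b hb => simp only [z_diamond, diamond_z, hb]
    | hx b hb =>
      induction c using word_induction with
      | h1 => simp only [diamond_one]
      | hadd c d hc hd => simp only [map_add, hc, hd]
      | hsmul r c hc => simp only [map_smul, hc]
      | hz c hc => simp only [diamond_z, hc]
      | hx c hc =>
        rw [diamond_x_x' a b, diamond_x_x', ← diamond_x_x' a b, hc, diamond_x_x' b c,
          diamond_x_x' a, ← diamond_x_x' b c]
        simp only [map_add, map_sub, LinearMap.add_apply, LinearMap.sub_apply, z_diamond,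
          diamond_z, ha, hb, mul_add, mul_sub]
        abel

/-- `yℚ⟨x, y⟩` is closed under `⋄`. -/
theorem diamond_mem_y (a b : NCPoly) : ∃ c, diamond (Y * a) (Y * b) = Y * c :=
  ⟨_, by rw [diamond_y_y, ← mul_sub]⟩


theorem ofForest_induction {P : CK → Prop} (hf : ∀ f, P (ofForest f))
    (hadd : ∀ a b, P a → P b → P (a + b)) (hsmul : ∀ (c : ℚ) a, P a → P (c • a)) (h : CK) :
    P h := by
  induction h using AddMonoidAlgebra.induction_linear with
  | zero => simpa using hsmul 0 _ (hf 0)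
  | add a b ha hb => exact hadd _ _ ha hb
  | single f r =>
    have : AddMonoidAlgebra.single f r = r • ofForest f := by simp [ofForest]
    rw [this]
    exact hsmul _ _ (hf f)

/-- The recursive rules of the polynomials `F_f`, where `f ↦ F_f` is linear. The operator
`L_y L_{x+2y} L_y⁻¹` is only applied to elements of `yℚ⟨x, y⟩`; it maps `y v` to `y (x + 2 y) v`. -/
structure IsTreePolynomial (F : CK →ₗ[ℚ] NCPoly) : Prop where
  empty : F (ofForest 0) = 1
  single : F (ofForest {graft 0}) = Y
  graft : ∀ f : Forest, f ≠ 0 → ∃ v : NCPoly,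
    F (ofForest f) = Y * v ∧ F (ofForest {graft f}) = Y * ((X + 2 * Y) * v)
  mul : ∀ g h : Forest, F (ofForest (g + h)) = diamond (F (ofForest g)) (F (ofForest h))

/-- Auxiliary operator: `1 ↦ y`, `y v ↦ y (x + 2 y) v`, `x v ↦ 0`. -/
noncomputable def polyGraft : NCPoly →ₗ[ℚ] NCPoly :=
  onWords fun l => match l with
    | [] => Y
    | .x :: _ => 0
    | .y :: l => Y * ((X + 2 * Y) * word l)

theorem polyGraft_one : polyGraft 1 = Y := by
  rw [polyGraft, ← word_nil, onWords_word]

theorem polyGraft_y (a : NCPoly) : polyGraft (Y * a) = Y * ((X + 2 * Y) * a) := by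
  have : polyGraft ∘ₗ LinearMap.mulLeft ℚ Y = LinearMap.mulLeft ℚ Y ∘ₗ LinearMap.mulLeft ℚ (X + 2 * Y) := linearMap_ext_word fun l => by
    simp only [LinearMap.comp_apply, LinearMap.mulLeft_apply, ← word_y]
    rw [polyGraft, onWords_word]
  exact congrArg (fun φ => φ a) this

theorem existsUnique_treePolynomial : ∃! F : CK →ₗ[ℚ] NCPoly, IsTreePolynomial F := by
  obtain ⟨φ, hφ⟩ := exists_fold (M := Module.End ℚ NCPoly)
    (fun p => diamond (polyGraft (p 1)))
    (by
      intro s t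
      cases s with | node l =>
      cases t with | node m =>
      rw [PlaneTree.fold, PlaneTree.fold]
      refine LinearMap.ext fun a => ?_
      simp only [Module.End.mul_apply]
      rw [← diamond_assoc, ← diamond_assoc, diamond_comm (polyGraft _)])
  have h1 : ∀ f : Forest, φ (.ofAdd f) = diamond (φ (.ofAdd f) 1) := by
    intro f
    induction f using Forest.induction with
    | h0 =>
      rw [ofAdd_zero, map_one]
      refine LinearMap.ext fun a => ?_
      simp [one_diamond]
    | hg f ih => rw [hφ, diamond_one]
    | hadd f g hf hg =>
      rw [ofAdd_add, map_mul, hf, hg]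
      refine LinearMap.ext fun a => ?_
      simp only [Module.End.mul_apply, diamond_one, diamond_assoc]
  let F : CK →ₗ[ℚ] NCPoly := (LinearMap.applyₗ (R := ℚ) (1 : NCPoly)) ∘ₗ
    (AddMonoidAlgebra.lift ℚ (Module.End ℚ NCPoly) Forest φ).toLinearMap
  have hF : ∀ f, F (ofForest f) = φ (.ofAdd f) 1 := fun f => by
    simp [F, ofForest, AddMonoidAlgebra.lift_single]
  have hempty : F (ofForest 0) = 1 := by
    rw [hF, ofAdd_zero]
    exact congrArg (fun ψ : Module.End ℚ NCPoly => ψ 1) (map_one φ)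
  have htree : ∀ f, F (ofForest {graft f}) = polyGraft (F (ofForest f)) := by
    intro f
    rw [hF, hφ, diamond_one, hF]
  have hmul : ∀ g h : Forest,
      F (ofForest (g + h)) = diamond (F (ofForest g)) (F (ofForest h)) := by
    intro g h
    rw [hF, ofAdd_add, map_mul, Module.End.mul_apply, h1 g, ← hF, ← hF]
  have hy : ∀ f : Forest, f ≠ 0 → ∃ v, F (ofForest f) = Y * v := by
    intro f
    induction f using Forest.induction with
    | h0 => intro h; exact absurd rfl h
    | hg f ih =>
      intro _
      rw [htree]
      by_cases hf : f = 0
      · exact ⟨1, by rw [hf, hempty, polyGraft_one, mul_one]⟩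
      · obtain ⟨v, hv⟩ := ih hf
        exact ⟨_, by rw [hv, polyGraft_y]⟩
    | hadd f g hf hg =>
      intro hfg
      by_cases hf0 : f = 0
      · by_cases hg0 : g = 0
        · exact absurd (by rw [hf0, hg0, add_zero]) hfg
        · simpa [hf0] using hg hg0
      · by_cases hg0 : g = 0
        · simpa [hg0] using hf hf0
        · obtain ⟨v, hv⟩ := hf hf0
          obtain ⟨w, hw⟩ := hg hg0
          rw [hmul, hv, hw]
          exact diamond_mem_y v w
  refine ⟨F, ⟨hempty, by rw [htree, hempty, polyGraft_one], ?_, hmul⟩, ?_⟩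
  · intro f hf
    obtain ⟨v, hv⟩ := hy f hf
    exact ⟨v, hv, by rw [htree, hv, polyGraft_y]⟩
  · intro F' h'
    refine linearMap_ext_forest fun f => ?_
    induction f using Forest.induction with
    | h0 => rw [h'.empty, hempty]
    | hg f ih =>
      rw [htree]
      by_cases hf : f = 0
      · rw [hf, h'.single, hempty, polyGraft_one]
      · obtain ⟨v, hv, hv'⟩ := h'.graft f hf
        rw [hv', ← ih, hv, polyGraft_y]
    | hadd f g hf hg => rw [h'.mul, hmul, hf, hg]

/-- The linear map `f ↦ F_f`. -/
noncomputable def treePolynomial : CK →ₗ[ℚ] NCPoly := existsUnique_treePolynomial.choose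

theorem isTreePolynomial_treePolynomial : IsTreePolynomial treePolynomial :=
  existsUnique_treePolynomial.choose_spec.1

/-- The recursive rules of the rooted tree maps `f̃ = T f`, where `f ↦ f̃` is linear. The operator
`L_y L_{x+2y} L_y⁻¹` is only applied to elements of `yℚ⟨x, y⟩`; it maps `y v` to `y (x + 2 y) v`.
In the last rule, `∑ f̃'(u) f̃''(w)` for `Δ(f) = ∑ f' ⊗ f''` is the image of `Δ(f)` under the linear
map with `f' ⊗ f'' ↦ f̃'(u) f̃''(w)`. -/
structure IsRootedTreeMap (T : CK →ₗ[ℚ] NCPoly →ₗ[ℚ] NCPoly) : Prop where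
  empty : T (ofForest 0) = LinearMap.id
  single_x : T (ofForest {graft 0}) X = Y * X
  single_y : T (ofForest {graft 0}) Y = -(Y * X)
  graft : ∀ f : Forest, f ≠ 0 → ∀ u : NCPoly, u = X ∨ u = Y → ∃ v : NCPoly,
    T (ofForest f) u = Y * v ∧ T (ofForest {graft f}) u = Y * ((X + 2 * Y) * v)
  mul : ∀ (g h : CK) (u : NCPoly), T (g * h) u = T g (T h u)
  coproduct : ∀ (f : CK) (u w : NCPoly), u = X ∨ u = Y →
    T f (u * w) =
      LinearMap.mul' ℚ NCPoly (TensorProduct.map (T.flip u) (T.flip w) (coproduct f))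

/-- Auxiliary operator: `1 ↦ 0`, `x v ↦ x v`, `y v ↦ (x + 2 y) v`. -/
noncomputable def mapGraft : NCPoly →ₗ[ℚ] NCPoly :=
  onWords fun l => match l with
    | [] => 0
    | .x :: l => X * word l
    | .y :: l => (X + 2 * Y) * word l

theorem mapGraft_x (a : NCPoly) : mapGraft (X * a) = X * a := by
  have : mapGraft ∘ₗ LinearMap.mulLeft ℚ X = LinearMap.mulLeft ℚ X := linearMap_ext_word fun l => by
    simp only [LinearMap.comp_apply, LinearMap.mulLeft_apply]
    rw [← word_x, mapGraft, onWords_word, word_x]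
  exact congrArg (fun φ => φ a) this

theorem mapGraft_y (a : NCPoly) : mapGraft (Y * a) = (X + 2 * Y) * a := by
  have : mapGraft ∘ₗ LinearMap.mulLeft ℚ Y = LinearMap.mulLeft ℚ (X + 2 * Y) := linearMap_ext_word fun l => by
    simp only [LinearMap.comp_apply, LinearMap.mulLeft_apply]
    rw [← word_y, mapGraft, onWords_word]
  exact congrArg (fun φ => φ a) this

theorem mapGraft_z (a : NCPoly) : mapGraft ((X + Y) * a) = 2 * ((X + Y) * a) := by
  rw [add_mul, map_add, mapGraft_x, mapGraft_y]
  noncomm_ring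

/-- Auxiliary predicate: no constant term. -/
def NoConst (a : NCPoly) : Prop := ∃ b c, a = (X + Y) * b + X * c

theorem NoConst.add {a b : NCPoly} (ha : NoConst a) (hb : NoConst b) : NoConst (a + b) := by
  obtain ⟨p, q, rfl⟩ := ha
  obtain ⟨r, s, rfl⟩ := hb
  exact ⟨p + r, q + s, by rw [mul_add, mul_add]; abel⟩

theorem NoConst.smul {a : NCPoly} (c : ℚ) (ha : NoConst a) : NoConst (c • a) := by
  obtain ⟨p, q, rfl⟩ := ha
  exact ⟨c • p, c • q, by rw [smul_add, mul_smul_comm, mul_smul_comm]⟩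

theorem noConst_x (a : NCPoly) : NoConst (X * a) := ⟨0, a, by simp⟩

theorem noConst_z (a : NCPoly) : NoConst ((X + Y) * a) := ⟨a, 0, by simp⟩

theorem noConst_y (a : NCPoly) : NoConst (Y * a) := ⟨a, -a, by noncomm_ring⟩

theorem mapGraft_mul {a : NCPoly} (ha : NoConst a) (b : NCPoly) :
    mapGraft (a * b) = mapGraft a * b := by
  obtain ⟨p, q, rfl⟩ := ha
  simp only [add_mul _ _ b, map_add, mul_assoc, mapGraft_x, mapGraft_z]

/-- The values of `mapStep p` on words. -/
noncomputable def mapStepWord (p : Module.End ℚ NCPoly) : List Letter → NCPoly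
  | [] => 0
  | .x :: l => X * mapStepWord p l + Y * mapGraft (p (X * word l))
  | .y :: l => Y * mapStepWord p l - Y * mapGraft (p (X * word l))

/-- Auxiliary operator, which takes the rooted tree map of a forest `f` to that of `B₊(f)`. -/
noncomputable def mapStep (p : Module.End ℚ NCPoly) : Module.End ℚ NCPoly :=
  onWords (mapStepWord p)

section mapStep

variable (p : Module.End ℚ NCPoly)

theorem mapStep_one : mapStep p 1 = 0 := by
  rw [mapStep, ← word_nil, onWords_word, mapStepWord]

theorem mapStep_x (a : NCPoly) :
    mapStep p (X * a) = X * mapStep p a + Y * mapGraft (p (X * a)) := by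
  have : mapStep p ∘ₗ LinearMap.mulLeft ℚ X = LinearMap.mulLeft ℚ X ∘ₗ mapStep p + LinearMap.mulLeft ℚ Y ∘ₗ mapGraft ∘ₗ p ∘ₗ LinearMap.mulLeft ℚ X :=
    linearMap_ext_word fun l => by
      simp only [LinearMap.comp_apply, LinearMap.mulLeft_apply, LinearMap.add_apply]
      rw [← word_x, mapStep, onWords_word, onWords_word, mapStepWord, word_x]
  exact congrArg (fun φ => φ a) this

theorem mapStep_y (a : NCPoly) :
    mapStep p (Y * a) = Y * mapStep p a - Y * mapGraft (p (X * a)) := by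
  have : mapStep p ∘ₗ LinearMap.mulLeft ℚ Y = LinearMap.mulLeft ℚ Y ∘ₗ mapStep p - LinearMap.mulLeft ℚ Y ∘ₗ mapGraft ∘ₗ p ∘ₗ LinearMap.mulLeft ℚ X :=
    linearMap_ext_word fun l => by
      simp only [LinearMap.comp_apply, LinearMap.mulLeft_apply, LinearMap.sub_apply]
      rw [← word_y, mapStep, onWords_word, onWords_word, mapStepWord]
  exact congrArg (fun φ => φ a) this

theorem mapStep_z (a : NCPoly) : mapStep p ((X + Y) * a) = (X + Y) * mapStep p a := by
  rw [add_mul, map_add, mapStep_x, mapStep_y, add_mul]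
  abel

theorem eq_mapStep {s : Module.End ℚ NCPoly} (h1 : s 1 = 0)
    (hx : ∀ a, s (X * a) = X * s a + Y * mapGraft (p (X * a)))
    (hy : ∀ a, s (Y * a) = Y * s a - Y * mapGraft (p (X * a))) : s = mapStep p := by
  refine linearMap_ext_word fun l => ?_
  induction l with
  | nil => rw [word_nil, h1, mapStep_one]
  | cons c l ih =>
    cases c with
    | x => rw [word_x, hx, mapStep_x, ih]
    | y => rw [word_y, hy, mapStep_y, ih]

end mapStep

/-- Auxiliary predicate: compatible with left multiplication by `x + y`, and no constant terms. -/
def Good (p : Module.End ℚ NCPoly) : Prop :=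
  (∀ a, p ((X + Y) * a) = (X + Y) * p a) ∧ ∀ a, NoConst (p (X * a))

theorem good_one : Good 1 := ⟨fun _ => rfl, fun a => noConst_x a⟩

theorem Good.mul {p q : Module.End ℚ NCPoly} (hp : Good p) (hq : Good q) : Good (p * q) := by
  refine ⟨fun a => ?_, fun a => ?_⟩
  · rw [Module.End.mul_apply, hq.1, hp.1]; rfl
  · obtain ⟨b, c, h⟩ := hq.2 a
    rw [Module.End.mul_apply, h, map_add, hp.1]
    exact (noConst_z _).add (hp.2 c)

theorem Good.step {p : Module.End ℚ NCPoly} : Good (mapStep p) := by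
  refine ⟨mapStep_z p, fun a => ?_⟩
  rw [mapStep_x]
  exact (noConst_x _).add (noConst_y _)

theorem mapStep_graft {p : Module.End ℚ NCPoly} (hp : Good p) {a : NCPoly} (ha : NoConst a) :
    mapStep p (Y * mapGraft a) = Y * mapGraft (mapStep p a) +
      Y * mapGraft (p (Y * mapGraft a)) - 2 * (Y * ((X + Y) * p a)) -
      Y * ((X + Y) * mapGraft (p a)) := by
  obtain ⟨b, c, rfl⟩ := ha
  have hyz : ∀ v : NCPoly, Y * v = (X + Y) * v - X * v := fun v => by rw [add_mul]; abel
  have h1 : ∀ v : NCPoly, p (Y * v) = (X + Y) * p v - p (X * v) := fun v => by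
    rw [hyz, map_sub, hp.1]
  have two : ∀ (q : Module.End ℚ NCPoly) (v : NCPoly), q (2 * v) = 2 * q v := fun q v => by
    rw [two_mul, two_mul, map_add]
  simp only [map_add, mapGraft_x, mapGraft_z, mul_add Y, mapStep_y, mapStep_x, mapStep_z, h1,
    hp.1, two, mapGraft_y, map_sub]
  noncomm_ring

theorem commute_step {p q : Module.End ℚ NCPoly} (hp : Good p) (hq : Good q)
    (hpq : Commute p q) (hpt : Commute p (mapStep q)) (hsq : Commute (mapStep p) q) :
    Commute (mapStep p) (mapStep q) := by
  have e1 : ∀ a, p (q a) = q (p a) := fun a => congrArg (fun φ => φ a) hpq.eq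
  have e2 : ∀ a, p (mapStep q a) = mapStep q (p a) := fun a => congrArg (fun φ => φ a) hpt.eq
  have e3 : ∀ a, mapStep p (q a) = q (mapStep p a) := fun a => congrArg (fun φ => φ a) hsq.eq
  refine LinearMap.ext fun a => ?_
  simp only [Module.End.mul_apply]
  induction a using word_induction with
  | h1 => simp only [mapStep_one, map_zero]
  | hadd a b ha hb => simp only [map_add, ha, hb]
  | hsmul c a ha => simp only [map_smul, ha]
  | hz a ha => simp only [mapStep_z, ha]
  | hx a ha =>
    have k1 : X * mapStep q a = mapStep q (X * a) - Y * mapGraft (q (X * a)) := by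
      rw [mapStep_x]; abel
    have k2 : X * mapStep p a = mapStep p (X * a) - Y * mapGraft (p (X * a)) := by
      rw [mapStep_x]; abel
    rw [mapStep_x q a, mapStep_x p a, map_add, map_add, mapStep_x p, mapStep_x q, k1, k2,
      mapStep_graft hp (hq.2 a), mapStep_graft hq (hp.2 a), ha]
    simp only [map_sub, e2, e1, ← e3, mul_sub]
    abel

theorem good_fold (t : PlaneTree) : Good (t.fold mapStep) := by
  cases t with | node l =>
  rw [PlaneTree.fold]
  exact Good.step

theorem good_fold_prod (l : List PlaneTree) : Good (l.map (PlaneTree.fold mapStep)).prod := by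
  induction l with
  | nil => exact good_one
  | cons t l ih =>
    rw [List.map_cons, List.prod_cons]
    exact (good_fold t).mul ih

theorem commute_fold (s t : PlaneTree) : Commute (s.fold mapStep) (t.fold mapStep) := by
  induction s using PlaneTree.induction generalizing t with
  | h l ihl =>
    induction t using PlaneTree.induction with
    | h m ihm =>
      have hl : ∀ t : PlaneTree, Commute (l.map (PlaneTree.fold mapStep)).prod
          (t.fold mapStep) := by
        intro t
        refine Commute.list_prod_left _ _ fun x hx => ?_
        obtain ⟨s, hs, rfl⟩ := List.mem_map.1 hx
        exact ihl s hs t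
      have hm : Commute ((PlaneTree.node l).fold mapStep)
          (m.map (PlaneTree.fold mapStep)).prod := by
        refine Commute.list_prod_right _ _ fun x hx => ?_
        obtain ⟨t, ht, rfl⟩ := List.mem_map.1 hx
        exact ihm t ht
      have hlm : Commute (l.map (PlaneTree.fold mapStep)).prod
          (m.map (PlaneTree.fold mapStep)).prod := by
        refine Commute.list_prod_right _ _ fun x hx => ?_
        obtain ⟨t, _, rfl⟩ := List.mem_map.1 hx
        exact hl t
      have hlt := hl (.node m)
      rw [PlaneTree.fold] at hm hlt ⊢
      rw [PlaneTree.fold]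
      exact commute_step (good_fold_prod l) (good_fold_prod m) hlm hlt hm

/-- Auxiliary map: `f' ⊗ f'' ↦ f̃'(u) f̃''(w)`. -/
noncomputable def pairing (T : CK →ₗ[ℚ] NCPoly →ₗ[ℚ] NCPoly) (u w : NCPoly) :
    CK ⊗[ℚ] CK →ₗ[ℚ] NCPoly :=
  LinearMap.mul' ℚ NCPoly ∘ₗ TensorProduct.map (T.flip u) (T.flip w)

theorem pairing_tmul (T : CK →ₗ[ℚ] NCPoly →ₗ[ℚ] NCPoly) (u w : NCPoly) (g h : CK) :
    pairing T u w (g ⊗ₜ h) = T g u * T h w := by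
  simp [pairing]

theorem pairing_coproduct_graft (T : CK →ₗ[ℚ] NCPoly →ₗ[ℚ] NCPoly)
    (h0 : T (ofForest 0) = LinearMap.id) (u w : NCPoly) (f : Forest) :
    pairing T u w (coproduct (ofForest {graft f})) = u * T (ofForest {graft f}) w +
      pairing T u w (TensorProduct.map Bplus LinearMap.id (coproduct (ofForest f))) := by
  rw [isCoproduct_coproduct f, map_add, pairing_tmul, ← ofForest_zero, h0, LinearMap.id_apply]

theorem pairing_Bplus (T : CK →ₗ[ℚ] NCPoly →ₗ[ℚ] NCPoly) (u : NCPoly)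
    (hT : ∀ h, T (Bplus h) u = Y * mapGraft (T h u)) (hc : ∀ h, NoConst (T h u)) (w : NCPoly)
    (d : CK ⊗[ℚ] CK) : pairing T u w (TensorProduct.map Bplus LinearMap.id d) =
      Y * mapGraft (pairing T u w d) := by
  induction d using TensorProduct.induction_on with
  | zero => simp
  | tmul g h =>
    rw [TensorProduct.map_tmul, pairing_tmul, pairing_tmul, mapGraft_mul (hc g), hT, mul_assoc]
    rfl
  | add a b ha hb => simp only [map_add, ha, hb, mul_add]

theorem isRootedTreeMap_step {T : CK →ₗ[ℚ] NCPoly →ₗ[ℚ] NCPoly} (h : IsRootedTreeMap T)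
    (f : Forest) : T (ofForest {graft f}) = mapStep (T (ofForest f)) := by
  have hx1 : ∀ f, T (ofForest {graft f}) X = Y * mapGraft (T (ofForest f) X) := by
    intro f
    by_cases hf : f = 0
    · rw [hf, h.single_x, h.empty, LinearMap.id_apply, ← mul_one X, mapGraft_x]
    · obtain ⟨v, hv, hv'⟩ := h.graft f hf X (.inl rfl)
      rw [hv', hv, mapGraft_y]
  have hz : ∀ f : Forest, f ≠ 0 → T (ofForest f) (X + Y) = 0 := by
    intro f
    induction f using Forest.induction with
    | h0 => intro h; exact absurd rfl h
    | hg f ih =>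
      intro _
      by_cases hf : f = 0
      · rw [hf, map_add, h.single_x, h.single_y, add_neg_cancel]
      · obtain ⟨v, hv, hv'⟩ := h.graft f hf Y (.inr rfl)
        have e : T (ofForest {RootedTrees.graft f}) Y = Y * mapGraft (T (ofForest f) Y) := by
          rw [hv', hv, mapGraft_y]
        rw [map_add, hx1, e, ← mul_add, ← map_add, ← map_add, ih hf, map_zero, mul_zero]
    | hadd f g hf hg =>
      intro hfg
      rw [ofForest_add, h.mul]
      by_cases hg0 : g = 0
      · by_cases hf0 : f = 0
        · exact absurd (by rw [hf0, hg0, add_zero]) hfg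
        · rw [hg0, h.empty, LinearMap.id_apply, hf hf0]
      · rw [hg hg0, map_zero]
  have hcx : ∀ a : CK, NoConst (T a X) := by
    intro a
    induction a using ofForest_induction with
    | hf f =>
      by_cases hf : f = 0
      · rw [hf, h.empty, LinearMap.id_apply, ← mul_one X]
        exact noConst_x 1
      · obtain ⟨v, hv, _⟩ := h.graft f hf X (.inl rfl)
        rw [hv]
        exact noConst_y v
    | hadd a b ha hb => rw [map_add]; exact ha.add hb
    | hsmul c a ha => rw [map_smul]; exact ha.smul c
  have hBx : ∀ a, T (Bplus a) X = Y * mapGraft (T a X) := by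
    intro a
    induction a using ofForest_induction with
    | hf f => rw [Bplus_ofForest, hx1]
    | hadd a b ha hb => simp only [map_add, LinearMap.add_apply, ha, hb, mul_add]
    | hsmul c a ha => simp only [map_smul, LinearMap.smul_apply, ha, mul_smul_comm]
  have hBy : ∀ a, T (Bplus a) Y = -T (Bplus a) X := by
    intro a
    induction a using ofForest_induction with
    | hf f =>
      have := hz {graft f} (Multiset.singleton_ne_zero _)
      rw [map_add] at this
      rw [Bplus_ofForest]
      exact (neg_eq_of_add_eq_zero_right this).symm
    | hadd a b ha hb => simp only [map_add, LinearMap.add_apply, ha, hb, neg_add]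
    | hsmul c a ha => simp only [map_smul, LinearMap.smul_apply, ha, smul_neg]
  have hpy : ∀ (w : NCPoly) (d : CK ⊗[ℚ] CK),
      pairing T Y w (TensorProduct.map Bplus LinearMap.id d) =
        -pairing T X w (TensorProduct.map Bplus LinearMap.id d) := by
    intro w d
    induction d using TensorProduct.induction_on with
    | zero => simp
    | tmul a b =>
      rw [TensorProduct.map_tmul, pairing_tmul, pairing_tmul, hBy, neg_mul]
    | add a b ha hb => simp only [map_add, ha, hb, neg_add]
  have hcop : ∀ (f : Forest) (u w : NCPoly), u = X ∨ u = Y →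
      T (ofForest f) (u * w) = pairing T u w (coproduct (ofForest f)) :=
    fun f u w hu => h.coproduct _ u w hu
  have hx : ∀ w, T (ofForest {graft f}) (X * w) =
      X * T (ofForest {graft f}) w + Y * mapGraft (T (ofForest f) (X * w)) := by
    intro w
    rw [hcop _ _ _ (.inl rfl), pairing_coproduct_graft T h.empty, pairing_Bplus T X hBx hcx,
      ← hcop _ _ _ (.inl rfl)]
  have hy : ∀ w, T (ofForest {graft f}) (Y * w) =
      Y * T (ofForest {graft f}) w - Y * mapGraft (T (ofForest f) (X * w)) := by
    intro w
    rw [hcop _ _ _ (.inr rfl), pairing_coproduct_graft T h.empty, hpy,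
      pairing_Bplus T X hBx hcx, ← hcop _ _ _ (.inl rfl), sub_eq_add_neg]
  have h1 : T (ofForest {graft f}) 1 = 0 := by
    have e := hx 1
    rw [mul_one, hx1, right_eq_add] at e
    exact (mul_eq_zero.1 e).resolve_left (FreeAlgebra.ι_ne_zero _)
  exact eq_mapStep _ h1 hx hy

theorem existsUnique_rootedTreeMap :
    ∃! T : CK →ₗ[ℚ] NCPoly →ₗ[ℚ] NCPoly, IsRootedTreeMap T := by
  obtain ⟨φ, hφ⟩ := exists_fold mapStep commute_fold
  let Θ : CK →ₐ[ℚ] Module.End ℚ NCPoly := AddMonoidAlgebra.lift ℚ _ _ φ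
  let T : CK →ₗ[ℚ] NCPoly →ₗ[ℚ] NCPoly := Θ.toLinearMap
  have hT : ∀ f, T (ofForest f) = φ (.ofAdd f) := fun f => by
    change Θ (ofForest f) = _
    simp [Θ, ofForest, AddMonoidAlgebra.lift_single]
  have h0 : T (ofForest 0) = LinearMap.id := (hT 0).trans (map_one φ)
  have hstep : ∀ f, T (ofForest {graft f}) = mapStep (T (ofForest f)) := fun f => by
    rw [hT, hφ, hT]
  have hmul : ∀ (g h : CK) (u : NCPoly), T (g * h) u = T g (T h u) := fun g h u =>
    congrArg (fun ψ : Module.End ℚ NCPoly => ψ u) (map_mul Θ g h)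
  have hgood : ∀ f, Good (T (ofForest f)) := by
    intro f
    induction f using Forest.induction with
    | h0 => rw [h0]; exact good_one
    | hg f _ => rw [hstep]; exact Good.step
    | hadd f g hf hg =>
      have : T (ofForest (f + g)) = (T (ofForest f) : Module.End ℚ NCPoly) * T (ofForest g) := by
        rw [ofForest_add]
        exact map_mul Θ _ _
      rw [this]
      exact hf.mul hg
  have hTz : ∀ (h : CK) (a : NCPoly), T h ((X + Y) * a) = (X + Y) * T h a := by
    intro h a
    induction h using ofForest_induction with
    | hf f => exact (hgood f).1 a
    | hadd b c hb hc => rw [map_add, LinearMap.add_apply, LinearMap.add_apply, hb, hc, mul_add]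
    | hsmul r b hb => rw [map_smul, LinearMap.smul_apply, LinearMap.smul_apply, hb, mul_smul_comm]
  have hTc : ∀ (h : CK) (a : NCPoly), NoConst (T h (X * a)) := by
    intro h a
    induction h using ofForest_induction with
    | hf f => exact (hgood f).2 a
    | hadd b c hb hc => rw [map_add]; exact hb.add hc
    | hsmul r b hb => rw [map_smul]; exact hb.smul r
  have hB1 : ∀ h, T (Bplus h) 1 = 0 := by
    intro h
    induction h using ofForest_induction with
    | hf f => rw [Bplus_ofForest, hstep, mapStep_one]
    | hadd b c hb hc => rw [map_add, map_add, LinearMap.add_apply, hb, hc, add_zero]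
    | hsmul r b hb => rw [map_smul, map_smul, LinearMap.smul_apply, hb, smul_zero]
  have hBx : ∀ h a, T (Bplus h) (X * a) = X * T (Bplus h) a + Y * mapGraft (T h (X * a)) := by
    intro h a
    induction h using ofForest_induction with
    | hf f => rw [Bplus_ofForest, hstep, mapStep_x]
    | hadd b c hb hc =>
      simp only [map_add, LinearMap.add_apply, hb, hc, mul_add]
      abel
    | hsmul r b hb =>
      simp only [map_smul, LinearMap.smul_apply, hb, mul_smul_comm, smul_add]
  have hcop : ∀ (f : Forest) (a b : NCPoly),
      T (ofForest f) (a * b) = pairing T a b (coproduct (ofForest f)) := by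
    intro f
    induction f using Forest.induction with
    | h0 =>
      intro a b
      rw [ofForest_zero, map_one coproduct, Algebra.TensorProduct.one_def, pairing_tmul, ← ofForest_zero, h0]
      rfl
    | hadd f g hf hg =>
      intro a b
      have hf' : ∀ d : CK ⊗[ℚ] CK, T (ofForest f) (pairing T a b d) =
          pairing T a b (coproduct (ofForest f) * d) := by
        intro d
        induction d using TensorProduct.induction_on with
        | zero => simp
        | add d e hd he => simp only [map_add, mul_add, hd, he]
        | tmul c d =>
          rw [pairing_tmul, hf]
          generalize coproduct (ofForest f) = e
          induction e using TensorProduct.induction_on with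
          | zero => simp
          | add p q hp hq => simp only [map_add, add_mul, hp, hq]
          | tmul p q =>
            rw [pairing_tmul, Algebra.TensorProduct.tmul_mul_tmul, pairing_tmul, hmul, hmul]
      rw [ofForest_add, hmul, hg, hf', map_mul coproduct]
    | hg f ih =>
      intro a b
      rw [pairing_coproduct_graft T h0]
      have ih' := fun a => ih a b
      generalize coproduct (ofForest f) = d at ih'
      induction a using word_induction with
      | h1 =>
        have : pairing T 1 b (TensorProduct.map Bplus LinearMap.id d) = 0 := by
          clear ih'
          induction d using TensorProduct.induction_on with
          | zero => simp
          | add p q hp hq => rw [map_add, map_add, hp, hq, add_zero]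
          | tmul p q => rw [TensorProduct.map_tmul, pairing_tmul, hB1, zero_mul]
        rw [this, one_mul, one_mul, add_zero]
      | hadd a c ha hc =>
        rw [add_mul, map_add, ha, hc]
        simp only [pairing, map_add, TensorProduct.map_add_left, LinearMap.comp_add,
          LinearMap.add_apply, add_mul]
        abel
      | hsmul r a ha =>
        rw [smul_mul_assoc, map_smul, ha]
        simp only [pairing, map_smul, TensorProduct.map_smul_left, LinearMap.comp_smul,
          LinearMap.smul_apply, smul_mul_assoc, smul_add]
      | hz a ha =>
        have : pairing T ((X + Y) * a) b (TensorProduct.map Bplus LinearMap.id d) =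
            (X + Y) * pairing T a b (TensorProduct.map Bplus LinearMap.id d) := by
          clear ih' ha
          induction d using TensorProduct.induction_on with
          | zero => simp
          | add p q hp hq => rw [map_add, map_add, hp, hq, map_add, mul_add]
          | tmul p q => rw [TensorProduct.map_tmul, pairing_tmul, pairing_tmul, hTz, mul_assoc]
        rw [this, mul_assoc, hTz, ha, mul_add, mul_assoc]
      | hx a ha =>
        have : pairing T (X * a) b (TensorProduct.map Bplus LinearMap.id d) =
            X * pairing T a b (TensorProduct.map Bplus LinearMap.id d) +
              Y * mapGraft (pairing T (X * a) b d) := by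
          clear ih' ha
          induction d using TensorProduct.induction_on with
          | zero => simp
          | add p q hp hq =>
            simp only [map_add, hp, hq, mul_add]
            abel
          | tmul p q =>
            simp only [TensorProduct.map_tmul, pairing_tmul, hBx, mapGraft_mul (hTc p a),
              LinearMap.id_apply, add_mul, mul_assoc]
        rw [this, ← ih', mul_assoc, hstep, mapStep_x, ← hstep, ha, mul_add, mul_assoc, add_assoc]
  have hY : ∀ f : Forest, (∀ v, ∃ v', T (ofForest f) (Y * v) = Y * v') ∧
      (f ≠ 0 → T (ofForest f) 1 = 0 ∧ ∃ v, T (ofForest f) X = Y * v) := by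
    intro f
    induction f using Forest.induction with
    | h0 => exact ⟨fun v => ⟨v, by rw [h0]; rfl⟩, fun h => absurd rfl h⟩
    | hg f ih =>
      rw [hstep]
      refine ⟨fun v => ⟨_, by rw [mapStep_y, ← mul_sub]⟩, fun _ => ⟨mapStep_one _, ?_⟩⟩
      exact ⟨mapGraft (T (ofForest f) X), by
        rw [← mul_one X, mapStep_x, mapStep_one, mul_zero, zero_add]⟩
    | hadd f g hf hg =>
      have e : ∀ a, T (ofForest (f + g)) a = T (ofForest f) (T (ofForest g) a) := fun a => by
        rw [ofForest_add, hmul]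
      refine ⟨fun v => ?_, fun hfg => ?_⟩
      · obtain ⟨v', h'⟩ := hg.1 v
        rw [e, h']
        exact hf.1 v'
      · by_cases hg0 : g = 0
        · have hf0 : f ≠ 0 := fun hf0 => hfg (by rw [hf0, hg0, add_zero])
          rw [hg0, add_zero]
          exact hf.2 hf0
        · obtain ⟨h1, v, hv⟩ := hg.2 hg0
          rw [e, e, h1, map_zero, hv]
          exact ⟨rfl, hf.1 v⟩
  have hgx : ∀ f, T (ofForest {graft f}) X = Y * mapGraft (T (ofForest f) X) := fun f => by
    rw [hstep, ← mul_one X, mapStep_x, mapStep_one, mul_zero, zero_add]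
  have hgy : ∀ f, T (ofForest {graft f}) Y = -(Y * mapGraft (T (ofForest f) X)) := fun f => by
    rw [hstep, ← mul_one Y, mapStep_y, mapStep_one, mul_zero, zero_sub, mul_one, mul_one]
  have hxy : ∀ f : Forest, f ≠ 0 → T (ofForest f) Y = -T (ofForest f) X := fun f hf => by
    have := hTz (ofForest f) 1
    rw [(hY f).2 hf |>.1, mul_zero, mul_one, map_add] at this
    exact (neg_eq_of_add_eq_zero_right this).symm
  refine ⟨T, ⟨h0, ?_, ?_, ?_, hmul, ?_⟩, ?_⟩
  · rw [hgx, h0, LinearMap.id_apply, ← mul_one X, mapGraft_x]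
  · rw [hgy, h0, LinearMap.id_apply, ← mul_one X, mapGraft_x]
  · intro f hf u hu
    obtain ⟨v, hv⟩ := ((hY f).2 hf).2
    rcases hu with rfl | rfl
    · exact ⟨v, hv, by rw [hgx, hv, mapGraft_y]⟩
    · exact ⟨-v, by rw [hxy f hf, hv, mul_neg], by rw [hgy, hv, mapGraft_y, mul_neg, mul_neg]⟩
  · intro f u w _
    change T f (u * w) = pairing T u w (coproduct f)
    induction f using ofForest_induction with
    | hf f => exact hcop f u w
    | hadd a b ha hb => rw [map_add, map_add, map_add, LinearMap.add_apply, ha, hb]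
    | hsmul c a ha => rw [map_smul, map_smul, map_smul, LinearMap.smul_apply, ha]
  · intro T' h'
    refine linearMap_ext_forest fun f => ?_
    induction f using Forest.induction with
    | h0 => rw [h'.empty, h0]
    | hg f ih => rw [isRootedTreeMap_step h', hstep, ih]
    | hadd f g hf hg =>
      refine LinearMap.ext fun a => ?_
      rw [ofForest_add, h'.mul, hmul, hf, hg]

/-- The rooted tree maps: `rootedTreeMap f` is the linear map `f̃` on `ℚ⟨x, y⟩`. -/
noncomputable def rootedTreeMap : CK →ₗ[ℚ] NCPoly →ₗ[ℚ] NCPoly :=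
  existsUnique_rootedTreeMap.choose

theorem isRootedTreeMap_rootedTreeMap : IsRootedTreeMap rootedTreeMap :=
  existsUnique_rootedTreeMap.choose_spec.1

end RootedTrees

/-! Write `z = x + y` and `σ` for `mapGraft`, so that `σ(xv) = xv` and `σ(yv) = (x + 2y)v`. The
argument compares two recursions, one for the rooted tree map of `t = B₊(f)` and one for
`⋄`-multiplication by `F_t`.

The formula for `Δ(t)`, inserted in the product rule of the tree maps, gives `t̃(xw) = x t̃(w) + y
σ(f̃(xw))` and `t̃(yw) = y t̃(w) - y σ(f̃(xw))`. This is the operator `mapStep`; by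
`isRootedTreeMap_step` it takes `f̃` to `t̃`. Adding the two formulas shows that `t̃` commutes with
left multiplication by `z`, so it is determined by its behaviour under `w ↦ zw` and `w ↦ xw`,
starting from a single value.

On the other side, `⋄` also commutes with left multiplication by `z` in either argument, and `yb ⋄
xw = y(b ⋄ xw) + x(yb ⋄ w)`. Let `a = F_f` and `F_t = yb`. If `f̃` acts on words ending in `x`
through `a ⋄`, the two recursions agree as soon as `σ(a ⋄ xw) = b ⋄ xw`. For `f` nonempty one has `a
= yv` and `b = (x + 2y)v`, and this identity is `mapGraft_y_diamond_x`; for the empty forest `a = b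
= 1` and it is immediate. The transfer from `f` to `t` is `mapStep_mul_x`.

The product of forests corresponds to composition of tree maps and to `⋄` of the polynomials, so
that case of the induction is associativity of `⋄`. The final `x` in `wx` supplies the initial value
of the recursion: `t̃(1) = 0` carries no information, whereas `t̃(x) = y σ(f̃(x))` gives `yb`
followed by `x`. -/

namespace RootedTrees

/-- This is where the factor `x + 2y` matches the product: since `x + 2y = z + y` and `z` passes
through `⋄`, the right side is `z(v ⋄ xw) + yv ⋄ xw`. Expanding `yv ⋄ xw = y(v ⋄ xw) + x(yv ⋄ w)`,
both sides become `(x + 2y)(v ⋄ xw) + x(yv ⋄ w)`. -/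
theorem mapGraft_y_diamond_x (v w : NCPoly) :
    mapGraft (diamond (Y * v) (X * w)) = diamond ((X + 2 * Y) * v) (X * w) := by
  have h : (X + 2 * Y) * v = (X + Y) * v + Y * v := by noncomm_ring
  rw [h, map_add, LinearMap.add_apply, z_diamond, diamond_y_x, map_add, mapGraft_x, mapGraft_y]
  noncomm_ring

/-- Needed to pull a right factor out of `mapGraft`: this operator kills `1`, hence commutes with
right multiplication only on elements without constant term. -/
theorem noConst_y_diamond_x (v w : NCPoly) : NoConst (diamond (Y * v) (X * w)) := by
  rw [diamond_y_x]
  exact (noConst_y _).add (noConst_x _)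

/-- If `p` acts on `ℚ⟨x, y⟩x` through the `⋄`-multiplication by `a`, then `mapStep p` acts there
through the `⋄`-multiplication by `y b`, where `b` is the image of `a` under `mapGraft` in the sense
of the hypotheses `hx` and `hax`. -/
theorem mapStep_mul_x {p : Module.End ℚ NCPoly} {a b : NCPoly}
    (hp : ∀ w, p (w * X) = diamond a w * X) (hc : ∀ w, NoConst (diamond a (X * w)))
    (hx : mapGraft (a * X) = b * X)
    (hax : ∀ w, mapGraft (diamond a (X * w)) = diamond b (X * w)) (w : NCPoly) :
    mapStep p (w * X) = diamond (Y * b) w * X := by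
  induction w using word_induction with
  -- Here the value at `x` is computed from `p(x) = ax`. The hypothesis `hx` concerns `a * X` rather
  -- than `a`, because `a` may be the constant `1`: then `b = 1`, although `mapGraft 1 = 0`.
  | h1 =>
    have h := hp 1
    rw [diamond_one, one_mul] at h
    rw [one_mul, diamond_one, ← mul_one X, mapStep_x, mapStep_one, mul_one, h, hx, mul_zero,
      zero_add, mul_assoc]
  | hadd v w hv hw => rw [add_mul, map_add, hv, hw, map_add, add_mul]
  | hsmul c w hw => rw [smul_mul_assoc, map_smul, hw, map_smul, smul_mul_assoc]
  | hz w hw => rw [mul_assoc, mapStep_z, hw, diamond_z, mul_assoc]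
  | hx w hw =>
    -- The recursion gives `x(yb ⋄ w)x + y σ((a ⋄ xw)x)`. By `hc` the last `x` leaves `σ`, and `hax`
    -- turns the second term into `y(b ⋄ xw)x`; the sum is the expansion of `(yb ⋄ xw)x`.
    rw [mul_assoc, mapStep_x, hw, ← mul_assoc X w, hp, mapGraft_mul (hc w), hax, diamond_y_x,
      add_mul, mul_assoc, mul_assoc, add_comm]

/-- Induction over the generation of forests by grafting and union. The word `w` stays arbitrary:
grafting uses the hypothesis at all words, and union uses it at `F_g ⋄ w`. -/
theorem rootedTreeMap_ofForest_mul_x (f : Forest) (w : NCPoly) :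
    rootedTreeMap (ofForest f) (w * X) = diamond (treePolynomial (ofForest f)) w * X := by
  have hT := isRootedTreeMap_rootedTreeMap
  have hF := isTreePolynomial_treePolynomial
  induction f using Forest.induction generalizing w with
  | h0 => rw [hT.empty, hF.empty, one_diamond, LinearMap.id_apply]
  | hg f ih =>
    rw [isRootedTreeMap_step hT]
    by_cases hf : f = 0
    · subst hf
      rw [hF.empty] at ih
      -- For the empty forest `a = 1`, and `b = 1` because `F_• = y = y · 1`; the conditions reduce
      -- to `mapGraft` fixing every `xw`.
      have h := mapStep_mul_x (b := 1) ih (fun w => by rw [one_diamond]; exact noConst_x w)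
        (by rw [one_mul, ← mul_one X, mapGraft_x])
        (fun w => by rw [one_diamond, mapGraft_x]) w
      rw [h, hF.single, mul_one]
    · obtain ⟨v, hv, hv'⟩ := hF.graft f hf
      rw [hv] at ih
      rw [hv']
      -- Here `a = yv` and `b = (x + 2y)v`, so that `yb` is the polynomial of the grafted tree.
      exact mapStep_mul_x ih (noConst_y_diamond_x v)
        (by rw [mul_assoc, mapGraft_y, mul_assoc]) (mapGraft_y_diamond_x v) w
  -- After `g̃` the argument is `(F_g ⋄ w)x`, again ending in `x`, so the hypothesis for `f` applies
  -- to it and gives `(F_f ⋄ (F_g ⋄ w))x`.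
  | hadd f g hf hg => rw [ofForest_add, hT.mul, hg, hf, ← ofForest_add, hF.mul, diamond_assoc]

end RootedTrees

/-- Both sides are linear in `f`, so the case of a single forest suffices. -/
theorem theorem1 (f : RootedTrees.CK) (w : RootedTrees.NCPoly) :
    RootedTrees.rootedTreeMap f (w * RootedTrees.X) =
      RootedTrees.diamond (RootedTrees.treePolynomial f) w * RootedTrees.X := by
  induction f using RootedTrees.ofForest_induction with
  | hf f => exact RootedTrees.rootedTreeMap_ofForest_mul_x f w
  | hadd a b ha hb => simp only [map_add, LinearMap.add_apply, ha, hb, add_mul]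
  | hsmul c a ha => simp only [map_smul, LinearMap.smul_apply, ha, smul_mul_assoc]
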